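/- Let $q$ be an indeterminate and write $(z)_k=\prod_{i=0}^{k-1}(1-zq^i)$. Let $x=(x_1,\dots,x_n)$, let $a=(a_1,\dots,a_n)$ be a sequence of nonnegative integers, and put $|a|=a_1+\cdots+a_n$, $\sigma_k=a_1+\cdots+a_k$ and $\binom{|a|}{a}_q=\frac{(q)_{|a|}}{(q)_{a_1}\cdots(q)_{a_n}}$. Let $x^{(a)}$ be the alphabet consisting of the $|a|$ letters $x_iq^j$ with $1\le i\le n$ and $0\le j<a_i$, let $h_m$ be the $m$th complete symmetric function, and let $\mathrm{CT}[f]\in\mathbb{Q}(q)$ denote the constant term of a Laurent polynomial $f$ in $x_1,\dots,x_n$ over $\mathbb{Q}(q)$. For a sequence $v=(v_1,\dots,v_n)$ of nonnegative integers, write $x^{-v}=x_1^{-v_1}\cdots x_n^{-v_n}$, let $v^+$ be the partition obtained by sorting the entries of $v$ into weakly decreasing order (zeros omitted), and define \[ D_{v,(m)}(a)=\mathrm{CT}\bigg[x^{-v}\,h_m\big(x^{(a)}\big)\prod_{1\le i<j\le n}(x_i/x_j)_{a_i}(qx_j/x_i)_{a_j}\bigg]. \] Then for every positive integer $m$, all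 such $v$ and all such $a$, \[ D_{v,(m)}(a)=0\quad\text{if } v^+\neq(m), \] and \[ D_{v,(m)}(a)=\frac{q^{\sigma_n-\sigma_k}(1-q^{a_k})(q^{|a|})_m}{(1-q^{|a|})(q^{|a|-a_k+1})_m}\binom{|a|}{a}_q \quad\text{if } v=(\underbrace{0,\dots,0}_{k-1},m,\underbrace{0,\dots,0}_{n-k}), \] where for $|a|=0$ the right-hand side is read as $0$. -/

import Mathlib

namespace Kadell

/-- The coefficient field `ℚ(q)` of rational functions in one indeterminate. -/
abbrev K : Type := RatFunc ℚ

/-- The indeterminate `q`. -/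
noncomputable def q : K := RatFunc.X

/-- Laurent polynomials in `x_1, …, x_n` over `ℚ(q)`: the exponent vectors are integer sequences
of length `n`. -/
abbrev Laurent (n : ℕ) : Type := AddMonoidAlgebra K (Fin n → ℤ)

/-- The monomial `x^u = x_1^{u_1} ⋯ x_n^{u_n}`. -/
noncomputable def mono {n : ℕ} (u : Fin n → ℤ) : Laurent n := AddMonoidAlgebra.single u 1

/-- The variable `x_i`. -/
noncomputable def x {n : ℕ} (i : Fin n) : Laurent n := mono (Pi.single i 1)

/-- The ratio `x_i / x_j`. -/
noncomputable def ratio {n : ℕ} (i j : Fin n) : Laurent n :=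
  mono (Pi.single i 1 - Pi.single j 1)

/-- The constant term `CT[f]`: the coefficient of `x^0`. -/
noncomputable def CT {n : ℕ} (f : Laurent n) : K := f.coeff 0

/-- The element `q`, regarded as a constant Laurent polynomial. -/
noncomputable def qL (n : ℕ) : Laurent n := algebraMap K (Laurent n) q

/-- The shifted factorial `(z)_k = ∏_{i=0}^{k-1} (1 - z p^i)` with base `p`. -/
def qPoch {R : Type*} [CommRing R] (p z : R) (k : ℕ) : R :=
  ∏ i ∈ Finset.range k, (1 - z * p ^ i)

/-- `|a| = a_1 + ⋯ + a_n`. -/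
def total {n : ℕ} (a : Fin n → ℕ) : ℕ := ∑ i, a i

/-- The partial sum `σ_k = a_1 + ⋯ + a_k`. -/
def partialSum {n : ℕ} (a : Fin n → ℕ) (k : Fin n) : ℕ := ∑ i ∈ Finset.Iic k, a i

/-- The `q`-multinomial coefficient `(q)_{|a|} / ((q)_{a_1} ⋯ (q)_{a_n})`. -/
noncomputable def qMultinomial {n : ℕ} (a : Fin n → ℕ) : K :=
  qPoch q q (total a) / ∏ i, qPoch q q (a i)

/-- The alphabet `x^{(a)}`, consisting of the letters `x_i q^j` with `0 ≤ j < a_i`. -/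
noncomputable def alphabet {n : ℕ} (a : Fin n → ℕ) (s : Σ i : Fin n, Fin (a i)) : Laurent n :=
  x s.1 * qL n ^ (s.2 : ℕ)

/-- `h_m(x^{(a)})`: the complete symmetric function of degree `m` in the letters of `x^{(a)}`. -/
noncomputable def hAlphabet {n : ℕ} (a : Fin n → ℕ) (m : ℕ) : Laurent n :=
  MvPolynomial.aeval (alphabet a) (MvPolynomial.hsymm (Σ i : Fin n, Fin (a i)) K m)

/-- The `q`-Dyson product `∏_{i<j} (x_i/x_j)_{a_i} (q x_j/x_i)_{a_j}`. -/
noncomputable def dyson {n : ℕ} (a : Fin n → ℕ) : Laurent n :=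
  ∏ i, ∏ j ∈ Finset.Ioi i,
    qPoch (qL n) (ratio i j) (a i) * qPoch (qL n) (qL n * ratio j i) (a j)

/-- `D_{v,(m)}(a) = CT[x^{-v} h_m(x^{(a)}) ∏_{i<j} (x_i/x_j)_{a_i} (q x_j/x_i)_{a_j}]`. -/
noncomputable def D {n : ℕ} (v : Fin n → ℕ) (m : ℕ) (a : Fin n → ℕ) : K :=
  CT (mono (fun i => -(v i : ℤ)) * hAlphabet a m * dyson a)

/-- The partition `v^+` obtained by sorting the composition `v` into weakly decreasing order,
written without its tail of zeros. -/
def sortedParts {n : ℕ} (v : Fin n → ℕ) : List ℕ :=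
  ((Finset.univ.val.map v).filter (fun p => p ≠ 0)).sort (fun b c => c ≤ b)

end Kadell

/-! Clearing denominators turns $D_{v,(m)}(a)$ into the coefficient of $x^d$, $d_i=|a|-a_i+v_i$, in
the homogeneous polynomial $h_m(x^{(a)})$ times the cleared Dyson product (`D_eq_coeff`). If $|v|\ne
m$ it vanishes by degree. Otherwise $x^d$ has top degree, so the coefficient is a weighted sum of
values on any grid with $d_i+1$ nodes in direction $i$ (`coeff_eq_gridSum`), and terms of lower
degree may be added freely. The nodes are $1,q,\dots,q^{d_i}$, and $h_m(x^{(a)})$ is replaced by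
$h_m(x^{(a)}-Y)$ with $Y=\{1,q,\dots,q^{M-1}\}$, $M=|a|+m-1$ (`coeff_complete_mul_dysonPoly`).

At a node $x_i=q^{\alpha_i}$ where the Dyson product survives, the intervals
$[\alpha_i,\alpha_i+a_i)$ are disjoint, so $x^{(a)}$ becomes a set of $|a|$ distinct powers of $q$.
If this set lies in $Y$, only $m-1$ letters of $Y$ remain and $h_m(x^{(a)}-Y)=0$. Since
$\alpha_i+a_i\le|a|+v_i$, this kills every node when all $v_i<m$.

If $v=m e_k$, only the slice $\alpha_k=|a|-a_k+m$ survives. There $h_m(x^{(a)}-Y)$ supplies exactly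
the factors needed to complete part of the Dyson product to a constant. What remains is the Dyson
product in the other variables times polynomials in single variables, and reading the interpolation
backwards (`gridSum_eq_mul_central_coeff`) gives their leading coefficients times the $q$-Dyson
constant term. The same slicing, without $h_m$, proves the $q$-Dyson theorem by induction
(`central_coeff_insert_max`). -/

namespace Kadell

/-! ### Interpolation on grids of powers of `q` -/

section Interpolation

variable {ι F : Type*} [Fintype ι] [DecidableEq ι] [Field F]

/-- The barycentric weight of the node `p ^ j` among the nodes `p ^ l`, `l ∈ A`. -/
def nodeWeight (p : F) (A : Finset ℕ) (j : ℕ) : F := ∏ l ∈ A.erase j, (p ^ j - p ^ l)⁻¹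

/-- The sum of `f` over a grid, weighted by the barycentric weights. -/
def gridSum (p : F) (A : ι → Finset ℕ) (f : (ι → ℕ) → F) : F :=
  ∑ α ∈ Fintype.piFinset A, (∏ i, nodeWeight p (A i) (α i)) * f α

theorem nodeWeight_singleton (p : F) (j : ℕ) : nodeWeight p {j} j = 1 := by
  simp [nodeWeight]

/-- The weighted sum is the coefficient of $X^d$ in the Lagrange interpolant of $X^e$ on $d+1$
nodes, which is $X^e$ itself. -/
theorem sum_nodeWeight_mul_pow {p : F} (hp : Function.Injective fun j : ℕ => p ^ j)
    (A : Finset ℕ) (d e : ℕ) (hA : A.card = d + 1) (he : e ≤ d) :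
    ∑ j ∈ A, nodeWeight p A j * (p ^ j) ^ e = if e = d then 1 else 0 := by
  have h := Lagrange.coeff_eq_sum (s := A) (v := fun j : ℕ => p ^ j) hp.injOn
    (P := (Polynomial.X : Polynomial F) ^ e)
    (by rw [Polynomial.degree_X_pow, hA]; exact_mod_cast Nat.lt_succ_of_le he)
  rw [hA, Nat.add_sub_cancel, Polynomial.coeff_X_pow] at h
  rw [show (if e = d then (1 : F) else 0) = if d = e then 1 else 0 by simp [eq_comm], h]
  refine Finset.sum_congr rfl fun j _ => ?_
  simp [nodeWeight, div_eq_mul_inv, mul_comm]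

/-- The top coefficient of a polynomial as a weighted sum of its values on a grid. -/
theorem coeff_eq_gridSum {p : F} (hp : Function.Injective fun j : ℕ => p ^ j)
    (A : ι → Finset ℕ) (d : ι →₀ ℕ) (hA : ∀ i, (A i).card = d i + 1)
    (P : MvPolynomial ι F) (hP : P.totalDegree ≤ ∑ i, d i) :
    P.coeff d = gridSum p A fun α => MvPolynomial.eval (fun i => p ^ α i) P := by
  -- The weighted sum of a monomial factors over the directions. If $e\ne d$ has degree at most that
  -- of $d$, then some $e_i<d_i$, and the factor of direction $i$ vanishes.
  have hmono : ∀ e : ι →₀ ℕ, e ∈ P.support →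
      ∑ α ∈ Fintype.piFinset A, (∏ i, nodeWeight p (A i) (α i)) * ∏ i, (p ^ α i) ^ e i =
        if e = d then 1 else 0 := by
    intro e he
    have hle : ∑ i, e i ≤ ∑ i, d i := by
      refine le_trans ?_ hP
      rw [← Finsupp.degree_eq_sum]
      exact MvPolynomial.le_totalDegree he
    simp_rw [← Finset.prod_mul_distrib]
    rw [← Finset.prod_univ_sum A fun i j => nodeWeight p (A i) j * (p ^ j) ^ e i]
    split_ifs with hed
    · subst hed
      refine Finset.prod_eq_one fun i _ => ?_
      rw [sum_nodeWeight_mul_pow hp (A i) (e i) (e i) (hA i) le_rfl, if_pos rfl]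
    · obtain ⟨i, hi⟩ : ∃ i, e i < d i := by
        by_contra! hcon
        refine hed (Finsupp.ext fun i => ?_)
        exact ((Finset.sum_eq_sum_iff_of_le fun i _ => hcon i).mp
          (le_antisymm (Finset.sum_le_sum fun i _ => hcon i) hle) i (Finset.mem_univ i)).symm
      refine Finset.prod_eq_zero (Finset.mem_univ i) ?_
      rw [sum_nodeWeight_mul_pow hp (A i) (d i) (e i) (hA i) hi.le, if_neg hi.ne]
  unfold gridSum
  simp_rw [MvPolynomial.eval_eq', Finset.mul_sum]
  rw [Finset.sum_comm]
  have : ∀ e ∈ P.support, ∑ α ∈ Fintype.piFinset A,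
      (∏ i, nodeWeight p (A i) (α i)) * (P.coeff e * ∏ i, (p ^ α i) ^ e i) =
        if e = d then P.coeff e else 0 := by
    intro e he
    rw [show (if e = d then P.coeff e else 0) = P.coeff e * if e = d then 1 else 0 by simp,
      ← hmono e he, Finset.mul_sum]
    exact Finset.sum_congr rfl fun α _ => by ring
  rw [Finset.sum_congr rfl this, Finset.sum_ite_eq']
  split_ifs with h
  · rfl
  · exact MvPolynomial.notMem_support_iff.mp h

theorem gridSum_congr (p : F) (A : ι → Finset ℕ) {f g : (ι → ℕ) → F}
    (h : ∀ α, (∀ i, α i ∈ A i) → f α = g α) : gridSum p A f = gridSum p A g :=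
  Finset.sum_congr rfl fun α hα => by rw [h α (Fintype.mem_piFinset.mp hα)]

theorem gridSum_eq_zero (p : F) (A : ι → Finset ℕ) {f : (ι → ℕ) → F}
    (h : ∀ α, (∀ i, α i ∈ A i) → f α = 0) : gridSum p A f = 0 :=
  Finset.sum_eq_zero fun α hα => by rw [h α (Fintype.mem_piFinset.mp hα), mul_zero]

theorem gridSum_const_mul (p : F) (A : ι → Finset ℕ) (c : F) (f : (ι → ℕ) → F) :
    gridSum p A (fun α => c * f α) = c * gridSum p A f := by
  unfold gridSum
  rw [Finset.mul_sum]
  exact Finset.sum_congr rfl fun α _ => by ring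

/-- A function supported on a single node in direction `k` is summed over a smaller grid. -/
theorem gridSum_eq_of_support (p : F) (A : ι → Finset ℕ) (f : (ι → ℕ) → F) (k : ι) (N : ℕ)
    (hN : N ∈ A k) (h : ∀ α, (∀ i, α i ∈ A i) → α k ≠ N → f α = 0) :
    gridSum p A f = nodeWeight p (A k) N * gridSum p (Function.update A k {N}) f := by
  have hsub : Fintype.piFinset (Function.update A k {N}) ⊆ Fintype.piFinset A := by
    refine Fintype.piFinset_subset _ _ fun i => ?_
    by_cases hi : i = k
    · subst hi; simpa using hN
    · simp [hi]
  unfold gridSum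
  rw [← Finset.sum_subset hsub, Finset.mul_sum]
  · refine Finset.sum_congr rfl fun α hα => ?_
    rw [Fintype.mem_piFinset] at hα
    have hk : α k = N := by simpa using hα k
    rw [← Finset.mul_prod_erase Finset.univ _ (Finset.mem_univ k),
      ← Finset.mul_prod_erase Finset.univ (fun i => nodeWeight p (Function.update A k {N} i) (α i))
        (Finset.mem_univ k), hk, Function.update_self, nodeWeight_singleton, one_mul, mul_assoc]
    congr 2
    refine Finset.prod_congr rfl fun i hi => ?_
    rw [Function.update_of_ne (Finset.ne_of_mem_erase hi)]
  · intro α hα hα'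
    rw [Fintype.mem_piFinset] at hα
    rw [h α hα, mul_zero]
    intro hk
    refine hα' (Fintype.mem_piFinset.mpr fun i => ?_)
    by_cases hi : i = k
    · subst hi; simpa using hk
    · simpa [hi] using hα i

end Interpolation

/-! ### Top coefficients of products -/

section TopCoefficient

variable {ι R : Type*} [CommRing R]

theorem coeff_mul_aeval_X (H : MvPolynomial ι R) (d : ι →₀ ℕ) (hH : H.totalDegree ≤ d.degree)
    (i : ι) (P : Polynomial R) (e : ℕ) (hP : P.natDegree ≤ e) :
    (H * Polynomial.aeval (MvPolynomial.X i) P).coeff (d + Finsupp.single i e) =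
      P.coeff e * H.coeff d := by
  classical
  have hterm : ∀ r ∈ Finset.range (e + 1),
      (H * (MvPolynomial.C (P.coeff r) * MvPolynomial.X i ^ r)).coeff (d + Finsupp.single i e) =
        if r = e then P.coeff e * H.coeff d else 0 := by
    intro r hr
    have hre : r ≤ e := Nat.lt_succ_iff.mp (Finset.mem_range.mp hr)
    rw [show H * (MvPolynomial.C (P.coeff r) * MvPolynomial.X i ^ r) =
      MvPolynomial.C (P.coeff r) * (H * MvPolynomial.X i ^ r) by ring,
      MvPolynomial.coeff_C_mul, MvPolynomial.X_pow_eq_monomial,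
      show d + Finsupp.single i e = d + Finsupp.single i (e - r) + Finsupp.single i r by
        rw [add_assoc, ← Finsupp.single_add, Nat.sub_add_cancel hre],
      MvPolynomial.coeff_mul_monomial, mul_one]
    split_ifs with h
    · subst h; simp
    · rw [MvPolynomial.coeff_eq_zero_of_totalDegree_lt, mul_zero]
      refine lt_of_le_of_lt hH ?_
      change d.degree < (d + Finsupp.single i (e - r)).degree
      rw [map_add, Finsupp.degree_single]
      omega
  rw [Polynomial.aeval_eq_sum_range' (Nat.lt_succ_of_le hP), Finset.mul_sum,
    MvPolynomial.coeff_sum]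
  simp_rw [Algebra.smul_def, MvPolynomial.algebraMap_eq]
  rw [Finset.sum_congr rfl hterm]
  simp

theorem totalDegree_aeval_X_le (i : ι) (P : Polynomial R) (e : ℕ) (hP : P.natDegree ≤ e) :
    (Polynomial.aeval (MvPolynomial.X i : MvPolynomial ι R) P).totalDegree ≤ e := by
  rw [Polynomial.aeval_eq_sum_range' (Nat.lt_succ_of_le hP)]
  refine MvPolynomial.totalDegree_finsetSum_le fun r hr => ?_
  refine (MvPolynomial.totalDegree_smul_le _ _).trans ?_
  rw [MvPolynomial.X_pow_eq_monomial]
  refine (MvPolynomial.totalDegree_monomial_le _ _).trans ?_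
  simpa using Nat.lt_succ_iff.mp (Finset.mem_range.mp hr)

theorem totalDegree_mul_prod_aeval_X_le (H : MvPolynomial ι R) (s : Finset ι) (h : ℕ)
    (hH : H.totalDegree ≤ h) (P : ι → Polynomial R) (e : ι → ℕ)
    (hP : ∀ i ∈ s, (P i).natDegree ≤ e i) :
    (H * ∏ i ∈ s, Polynomial.aeval (MvPolynomial.X i) (P i)).totalDegree ≤
      h + ∑ i ∈ s, e i := by
  refine (MvPolynomial.totalDegree_mul _ _).trans (add_le_add hH ?_)
  refine (MvPolynomial.totalDegree_finsetProd _ _).trans ?_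
  exact Finset.sum_le_sum fun i hi => totalDegree_aeval_X_le i (P i) (e i) (hP i hi)

/-- The exponent has the largest total degree the product can reach, so only the coefficients of
degree $e_i$ in the $P_i$ contribute. -/
theorem coeff_mul_prod_aeval_X (H : MvPolynomial ι R) (d : ι →₀ ℕ)
    (hH : H.totalDegree ≤ d.degree) (s : Finset ι) (P : ι → Polynomial R) (e : ι → ℕ)
    (hP : ∀ i ∈ s, (P i).natDegree ≤ e i) :
    (H * ∏ i ∈ s, Polynomial.aeval (MvPolynomial.X i) (P i)).coeff
        (d + ∑ i ∈ s, Finsupp.single i (e i)) =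
      (∏ i ∈ s, (P i).coeff (e i)) * H.coeff d := by
  classical
  induction s using Finset.induction_on with
  | empty => simp
  | insert k s hk ih =>
    have hP' : ∀ i ∈ s, (P i).natDegree ≤ e i := fun i hi => hP i (Finset.mem_insert_of_mem hi)
    rw [Finset.prod_insert hk, Finset.prod_insert hk, Finset.sum_insert hk,
      show d + (Finsupp.single k (e k) + ∑ i ∈ s, Finsupp.single i (e i)) =
        (d + ∑ i ∈ s, Finsupp.single i (e i)) + Finsupp.single k (e k) by abel,
      mul_comm (Polynomial.aeval _ _), ← mul_assoc, coeff_mul_aeval_X, ih hP', mul_assoc]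
    · refine (totalDegree_mul_prod_aeval_X_le H s _ hH P e hP').trans (le_of_eq ?_)
      simp
    · exact hP k (Finset.mem_insert_self k s)

end TopCoefficient

/-! ### Complete symmetric functions -/

section Complete

variable {σ R : Type*} [Fintype σ] [DecidableEq σ] [CommRing R]

/-- The complete symmetric function of degree `m` in the letters `f i`. -/
def completeSum (f : σ → R) (m : ℕ) : R := ∑ s : Sym σ m, (s.1.map f).prod

theorem aeval_hsymm {S : Type*} [CommRing S] [Algebra S R] (f : σ → R) (m : ℕ) :
    MvPolynomial.aeval f (MvPolynomial.hsymm σ S m) = completeSum f m := by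
  simp [MvPolynomial.hsymm, completeSum, map_multiset_prod]

theorem map_completeSum {S : Type*} [CommRing S] (φ : R →+* S) (f : σ → R) (m : ℕ) :
    φ (completeSum f m) = completeSum (fun i => φ (f i)) m := by
  simp [completeSum, map_multiset_prod]

/-- A multiset of size $m$ is the same as its multiplicities, which are the exponents chosen from
the geometric series. -/
theorem mk_completeSum_eq_prod (f : σ → R) :
    PowerSeries.mk (completeSum f) = ∏ i, PowerSeries.mk fun k => f i ^ k := by
  ext m
  rw [PowerSeries.coeff_mk, PowerSeries.coeff_prod]
  simp_rw [PowerSeries.coeff_mk]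
  unfold completeSum
  rw [← Finset.sum_coe_sort (Finset.univ.finsuppAntidiag m)]
  refine Fintype.sum_equiv ((Sym.equivNatSum σ m).trans (Equiv.subtypeEquivRight fun P => ?_)) _ _
    fun s => ?_
  · simp [Finset.mem_finsuppAntidiag, Finsupp.sum_fintype]
  · simp only [Equiv.trans_apply, Equiv.subtypeEquivRight_apply_coe, Sym.coe_equivNatSum_apply_apply]
    rw [Finset.prod_multiset_map_count]
    exact Finset.prod_subset (Finset.subset_univ _) fun i _ hi => by
      have hcount : Multiset.count i s.1 = 0 :=
        Multiset.count_eq_zero_of_notMem fun h => hi (Multiset.mem_toFinset.mpr h)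
      exact (congrArg (f i ^ ·) hcount).trans (pow_zero _)

theorem mk_pow_mul_one_sub (r : R) :
    (PowerSeries.mk fun k => r ^ k) * (1 - PowerSeries.C r * PowerSeries.X) = 1 := by
  ext m
  rw [mul_sub, mul_one, ← mul_assoc, map_sub, PowerSeries.coeff_mk, PowerSeries.coeff_one]
  cases m with
  | zero => simp
  | succ m =>
    rw [PowerSeries.coeff_succ_mul_X, mul_comm, PowerSeries.coeff_C_mul, PowerSeries.coeff_mk]
    simp [pow_succ']

theorem mk_completeSum_mul_prod (f : σ → R) :
    PowerSeries.mk (completeSum f) * ∏ i, (1 - PowerSeries.C (f i) * PowerSeries.X) = 1 := by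
  rw [mk_completeSum_eq_prod, ← Finset.prod_mul_distrib]
  exact Finset.prod_eq_one fun i _ => mk_pow_mul_one_sub (f i)

end Complete

/-! ### Differences of alphabets of powers -/

section Alphabets

variable {R : Type*} [CommRing R]

/-- The series `∏ (1 - p ^ l X)` over `l ∈ U`. -/
noncomputable def eulerSeries (p : R) (U : Finset ℕ) : PowerSeries R :=
  ∏ l ∈ U, (1 - PowerSeries.C (p ^ l) * PowerSeries.X)

theorem coeff_succ_one_sub_mul (r : R) (G : PowerSeries R) (j : ℕ) :
    PowerSeries.coeff (j + 1) ((1 - PowerSeries.C r * PowerSeries.X) * G) =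
      PowerSeries.coeff (j + 1) G - r * PowerSeries.coeff j G := by
  rw [sub_mul, one_mul, map_sub, mul_assoc, PowerSeries.coeff_C_mul, mul_comm PowerSeries.X,
    PowerSeries.coeff_succ_mul_X]

theorem coeff_eulerSeries_eq_zero (p : R) (U : Finset ℕ) :
    ∀ j, U.card < j → PowerSeries.coeff j (eulerSeries p U) = 0 := by
  induction U using Finset.induction_on with
  | empty =>
    intro j hj
    rw [Finset.card_empty] at hj
    simp [eulerSeries, PowerSeries.coeff_one, hj.ne']
  | insert z U hz ih =>
    intro j hj
    rw [Finset.card_insert_of_notMem hz] at hj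
    obtain ⟨j, rfl⟩ : ∃ r, j = r + 1 := ⟨j - 1, by omega⟩
    rw [eulerSeries, Finset.prod_insert hz, coeff_succ_one_sub_mul]
    change PowerSeries.coeff _ (eulerSeries p U) - _ * PowerSeries.coeff _ (eulerSeries p U) = 0
    rw [ih _ (by omega), ih _ (by omega), mul_zero, sub_zero]

/-- In alphabet notation this is $h_{|U|+j}(w-U)=w^j\prod_{l\in U}(w-p^l)$; each new letter $p^z$
multiplies by $w-p^z$. -/
theorem coeff_eulerSeries_mul_geom (p w : R) (U : Finset ℕ) :
    ∀ j, PowerSeries.coeff (U.card + j) (eulerSeries p U * PowerSeries.mk fun k => w ^ k) =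
      w ^ j * ∏ l ∈ U, (w - p ^ l) := by
  induction U using Finset.induction_on with
  | empty => intro j; simp [eulerSeries]
  | insert z U hz ih =>
    intro j
    rw [eulerSeries, Finset.prod_insert hz, Finset.prod_insert hz, mul_assoc,
      Finset.card_insert_of_notMem hz, show U.card + 1 + j = U.card + j + 1 by omega,
      coeff_succ_one_sub_mul]
    change PowerSeries.coeff _ (eulerSeries p U * _) -
      _ * PowerSeries.coeff _ (eulerSeries p U * _) = _
    rw [ih j, add_assoc, ih (j + 1)]
    ring

variable {σ : Type*} [Fintype σ] [DecidableEq σ]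

/-- The letters indexed by $U$ cancel against $Y$, leaving a polynomial of degree $M-|U|<m$. -/
theorem coeff_eulerSeries_mul_complete_eq_zero (p : R) (f : σ → R) (U : Finset ℕ) (M m : ℕ)
    (hf : ∏ i, (1 - PowerSeries.C (f i) * PowerSeries.X) = eulerSeries p U)
    (hU : U ⊆ Finset.range M) (hcard : M < m + U.card) :
    PowerSeries.coeff m (eulerSeries p (Finset.range M) * PowerSeries.mk (completeSum f)) = 0 := by
  have h : eulerSeries p (Finset.range M) * PowerSeries.mk (completeSum f) =
      eulerSeries p (Finset.range M \ U) := by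
    have h1 : eulerSeries p (Finset.range M) =
        eulerSeries p (Finset.range M \ U) * eulerSeries p U := (Finset.prod_sdiff hU).symm
    rw [h1, ← hf, mul_assoc, mul_comm (∏ i, _), mk_completeSum_mul_prod, mul_one]
  rw [h]
  refine coeff_eulerSeries_eq_zero p _ _ ?_
  rw [Finset.card_sdiff_of_subset hU, Finset.card_range]
  have := Finset.card_le_card hU
  rw [Finset.card_range] at this
  omega

/-- Adjoining the letter $p^M$ to both alphabets makes $U$ cancel. What is left is $h_m$ of the
single letter $p^M$ minus an alphabet of exactly $m$ letters. -/
theorem coeff_eulerSeries_mul_complete (p : R) (f : σ → R) (U : Finset ℕ) (M m : ℕ)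
    (hf : ∏ i, (1 - PowerSeries.C (f i) * PowerSeries.X) = eulerSeries p U)
    (hU : U ⊆ Finset.range (M + 1)) (hcard : M + 1 = m + U.card) :
    PowerSeries.coeff m (eulerSeries p (Finset.range M) * PowerSeries.mk (completeSum f)) =
      ∏ l ∈ Finset.range (M + 1) \ U, (p ^ M - p ^ l) := by
  have h : eulerSeries p (Finset.range M) * PowerSeries.mk (completeSum f) =
      eulerSeries p (Finset.range (M + 1) \ U) * PowerSeries.mk fun k => (p ^ M) ^ k := by
    have h1 : eulerSeries p (Finset.range M) * (1 - PowerSeries.C (p ^ M) * PowerSeries.X) =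
        eulerSeries p (Finset.range (M + 1) \ U) * eulerSeries p U := by
      rw [eulerSeries, ← Finset.prod_range_succ]
      exact (Finset.prod_sdiff hU).symm
    have h2 := mk_completeSum_mul_prod f
    have h3 := mk_pow_mul_one_sub (p ^ M)
    rw [hf] at h2
    linear_combination (PowerSeries.mk (completeSum f) * PowerSeries.mk fun k => (p ^ M) ^ k) * h1 +
      (eulerSeries p (Finset.range (M + 1) \ U) * PowerSeries.mk fun k => (p ^ M) ^ k) * h2 -
      eulerSeries p (Finset.range M) * PowerSeries.mk (completeSum f) * h3
  have hc : (Finset.range (M + 1) \ U).card = m := by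
    rw [Finset.card_sdiff_of_subset hU, Finset.card_range]
    omega
  have := coeff_eulerSeries_mul_geom p (p ^ M) (Finset.range (M + 1) \ U) 0
  rw [hc, add_zero, pow_zero, one_mul] at this
  rw [h, this]

end Alphabets

/-! ### The homogeneous form of the Dyson product -/

section DysonPoly

open MvPolynomial (X C)

variable {ι F : Type*} [Field F]

/-- The polynomial form of the factor of the Dyson product belonging to the pair `i < j`. -/
noncomputable def pairPoly (p : F) (a : ι → ℕ) (i j : ι) : MvPolynomial ι F :=
  (∏ t ∈ Finset.range (a i), (X j - C (p ^ t) * X i)) *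
    ∏ t ∈ Finset.range (a j), (X i - C (p ^ (t + 1)) * X j)

theorem eval_pairPoly {p : F} (a : ι → ℕ) (i j : ι) (y : ι → F) :
    MvPolynomial.eval y (pairPoly p a i j) =
      (∏ t ∈ Finset.range (a i), (y j - p ^ t * y i)) *
        ∏ t ∈ Finset.range (a j), (y i - p ^ (t + 1) * y j) := by
  simp [pairPoly, map_prod]

/-- The exponents of the letters attached to `s` when `x_i` is specialised to `p ^ α i`. -/
def letterExponents (a α : ι → ℕ) (s : Finset ι) : Finset ℕ :=
  s.biUnion fun i => Finset.Ico (α i) (α i + a i)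

theorem isHomogeneous_pairPoly (p : F) (a : ι → ℕ) (i j : ι) :
    (pairPoly p a i j).IsHomogeneous (a i + a j) := by
  have h1 : ∀ (n : ℕ) (f : ℕ → F) (u v : ι),
      (∏ t ∈ Finset.range n, (X u - C (f t) * X v)).IsHomogeneous n := by
    intro n f u v
    have := MvPolynomial.IsHomogeneous.prod (Finset.range n)
      (fun t => (X u - C (f t) * X v : MvPolynomial ι F)) (fun _ => 1) fun t _ =>
        (MvPolynomial.isHomogeneous_X F u).sub (by
          simpa using (MvPolynomial.isHomogeneous_C ι (f t)).mul (MvPolynomial.isHomogeneous_X F v))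
    simpa using this
  exact (h1 _ _ _ _).mul (h1 _ _ _ _)

/-- The excluded positions are those where a factor with $t=\alpha_j-\alpha_i$ or
$t=\alpha_i-\alpha_j-1$ is zero. Because of the shift in $t+1$, for $i<j$ the interval of $i$ also
cannot start right where a nonempty interval of $j$ ends. -/
theorem eval_pairPoly_ne_zero {p : F} (a α : ι → ℕ) (i j : ι)
    (h : MvPolynomial.eval (fun i => p ^ α i) (pairPoly p a i j) ≠ 0) :
    ¬ (α i ≤ α j ∧ α j < α i + a i) ∧ ¬ (α j < α i ∧ α i ≤ α j + a j) := by
  rw [pairPoly, map_mul, map_prod, map_prod] at h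
  have h1 := Finset.prod_ne_zero_iff.mp (left_ne_zero_of_mul h)
  have h2 := Finset.prod_ne_zero_iff.mp (right_ne_zero_of_mul h)
  constructor
  · rintro ⟨hle, hlt⟩
    refine h1 (α j - α i) (Finset.mem_range.mpr (by omega)) ?_
    simp [← pow_add, Nat.sub_add_cancel hle]
  · rintro ⟨hlt, hle⟩
    refine h2 (α i - α j - 1) (Finset.mem_range.mpr (by omega)) ?_
    simp [← pow_add, show α i - α j - 1 + 1 + α j = α i by omega]

theorem card_letterExponents (a α : ι → ℕ) (s : Finset ι)
    (h : (s : Set ι).PairwiseDisjoint fun i => Finset.Ico (α i) (α i + a i)) :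
    (letterExponents a α s).card = ∑ i ∈ s, a i := by
  rw [letterExponents, Finset.card_biUnion h]
  simp

theorem prod_letterExponents {R : Type*} [CommMonoid R] (a α : ι → ℕ) (s : Finset ι)
    (h : (s : Set ι).PairwiseDisjoint fun i => Finset.Ico (α i) (α i + a i)) (f : ℕ → R) :
    ∏ l ∈ letterExponents a α s, f l = ∏ i ∈ s, ∏ t ∈ Finset.range (a i), f (α i + t) := by
  rw [letterExponents, Finset.prod_biUnion h]
  refine Finset.prod_congr rfl fun i _ => ?_
  rw [Finset.prod_Ico_eq_prod_range, Nat.add_sub_cancel_left]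

theorem letterExponents_subset_range (a α : ι → ℕ) (s : Finset ι) (M : ℕ)
    (h : ∀ i ∈ s, 0 < a i → α i + a i ≤ M) : letterExponents a α s ⊆ Finset.range M := by
  intro l hl
  obtain ⟨i, hi, hl⟩ := Finset.mem_biUnion.mp hl
  rw [Finset.mem_Ico] at hl
  have := h i hi (by omega)
  exact Finset.mem_range.mpr (by omega)

variable [LinearOrder ι]

/-- The polynomial form of the Dyson product in the variables indexed by `s`. -/
noncomputable def dysonPoly (p : F) (a : ι → ℕ) (s : Finset ι) : MvPolynomial ι F :=
  ∏ i ∈ s, ∏ j ∈ s, if i < j then pairPoly p a i j else 1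

/-- The exponents of the central monomial of `dysonPoly p a s`. -/
def centralDegree (a : ι → ℕ) (s : Finset ι) (i : ι) : ℕ :=
  if i ∈ s then ∑ j ∈ s.erase i, a j else 0

theorem dysonPoly_insert (p : F) (a : ι → ℕ) (s : Finset ι) (k : ι) (hk : k ∉ s) :
    dysonPoly p a (insert k s) = dysonPoly p a s *
      ∏ i ∈ s, if i < k then pairPoly p a i k else pairPoly p a k i := by
  have h : ∀ i ∈ s, (if i < k then pairPoly p a i k else pairPoly p a k i) =
      (if k < i then pairPoly p a k i else 1) * if i < k then pairPoly p a i k else 1 := by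
    intro i hi
    rcases lt_or_gt_of_ne (fun h : i = k => hk (h ▸ hi)) with hik | hik
    · rw [if_pos hik, if_neg hik.not_gt, one_mul, if_pos hik]
    · rw [if_neg hik.not_gt, if_pos hik, if_neg hik.not_gt, mul_one]
  rw [Finset.prod_congr rfl h, Finset.prod_mul_distrib]
  unfold dysonPoly
  rw [Finset.prod_insert hk, Finset.prod_insert hk, if_neg (lt_irrefl k), one_mul]
  simp_rw [Finset.prod_insert hk]
  rw [Finset.prod_mul_distrib]
  ring

theorem isHomogeneous_dysonPoly [Fintype ι] (p : F) (a : ι → ℕ) (s : Finset ι) :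
    (dysonPoly p a s).IsHomogeneous (∑ i, centralDegree a s i) := by
  have h : (dysonPoly p a s).IsHomogeneous
      (∑ i ∈ s, ∑ j ∈ s, if i < j then a i + a j else 0) := by
    refine MvPolynomial.IsHomogeneous.prod _ _ _ fun i _ =>
      MvPolynomial.IsHomogeneous.prod _ _ _ fun j _ => ?_
    split_ifs
    · exact isHomogeneous_pairPoly p a i j
    · exact MvPolynomial.isHomogeneous_one ι F
  convert h using 1
  have h1 : ∀ i j : ι, (if i < j then a i + a j else 0) =
      (if i < j then a i else 0) + if i < j then a j else 0 := by
    intro i j; split_ifs <;> rfl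
  simp_rw [h1, Finset.sum_add_distrib]
  rw [Finset.sum_comm, ← Finset.sum_add_distrib]
  simp_rw [centralDegree]
  rw [Finset.sum_ite_mem, Finset.univ_inter]
  refine Finset.sum_congr rfl fun i _ => ?_
  rw [← Finset.sum_add_distrib, ← Finset.filter_ne', Finset.sum_filter]
  refine Finset.sum_congr rfl fun j _ => ?_
  rcases lt_trichotomy i j with h | h | h
  · simp [h, h.ne', h.not_gt]
  · simp [h]
  · simp [h, h.ne, h.not_gt]

theorem eval_dysonPoly_ne_zero {p : F} (a α : ι → ℕ) (s : Finset ι)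
    (h : MvPolynomial.eval (fun i => p ^ α i) (dysonPoly p a s) ≠ 0) (i j : ι) (hi : i ∈ s)
    (hj : j ∈ s) (hij : i < j) :
    ¬ (α i ≤ α j ∧ α j < α i + a i) ∧ ¬ (α j < α i ∧ α i ≤ α j + a j) := by
  rw [dysonPoly, map_prod] at h
  have h1 := Finset.prod_ne_zero_iff.mp h i hi
  rw [map_prod] at h1
  have h2 := Finset.prod_ne_zero_iff.mp h1 j hj
  rw [if_pos hij] at h2
  exact eval_pairPoly_ne_zero a α i j h2

theorem pairwiseDisjoint_of_eval_dysonPoly_ne_zero {p : F} (a α : ι → ℕ) (s : Finset ι)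
    (h : MvPolynomial.eval (fun i => p ^ α i) (dysonPoly p a s) ≠ 0) :
    (s : Set ι).PairwiseDisjoint fun i => Finset.Ico (α i) (α i + a i) := by
  intro i hi j hj hij
  refine Finset.disjoint_left.mpr fun l hl hl' => ?_
  rw [Finset.mem_Ico] at hl hl'
  rcases lt_or_gt_of_ne hij with hlt | hlt
  · have := eval_dysonPoly_ne_zero a α s h i j hi hj hlt
    omega
  · have := eval_dysonPoly_ne_zero a α s h j i hj hi hlt
    omega

theorem centralDegree_insert_self (a : ι → ℕ) (s : Finset ι) (k : ι) (hk : k ∉ s) :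
    centralDegree a (insert k s) k = ∑ i ∈ s, a i := by
  simp [centralDegree, hk]

theorem centralDegree_insert_of_ne (a : ι → ℕ) (s : Finset ι) (k i : ι) (hk : k ∉ s)
    (hi : i ≠ k) :
    centralDegree a (insert k s) i = centralDegree a s i + if i ∈ s then a k else 0 := by
  by_cases his : i ∈ s
  · simp only [centralDegree, Finset.mem_insert, his, or_true, if_true]
    rw [Finset.erase_insert_of_ne (Ne.symm hi), Finset.sum_insert, add_comm]
    simp [hk]
  · simp [centralDegree, his, hi]

theorem centralDegree_add (a : ι → ℕ) (s : Finset ι) (i : ι) (hi : i ∈ s) :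
    centralDegree a s i + a i = ∑ j ∈ s, a j := by
  rw [centralDegree, if_pos hi, Finset.sum_erase_add _ _ hi]

end DysonPoly

/-! ### Products over consecutive powers -/

section Consecutive

variable {F : Type*} [Field F]

/-- The monic polynomial with roots `p ^ c, …, p ^ (c + l - 1)`. -/
noncomputable def rootPoly (p : F) (c l : ℕ) : Polynomial F :=
  ∏ t ∈ Finset.range l, (Polynomial.X - Polynomial.C (p ^ (c + t)))

theorem natDegree_rootPoly (p : F) (c l : ℕ) : (rootPoly p c l).natDegree = l := by
  rw [rootPoly, Polynomial.natDegree_prod_of_monic _ _ fun _ _ => Polynomial.monic_X_sub_C _]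
  simp only [Polynomial.natDegree_X_sub_C, Finset.sum_const, Finset.card_range, smul_eq_mul,
    mul_one]

theorem monic_rootPoly (p : F) (c l : ℕ) : (rootPoly p c l).Monic :=
  Polynomial.monic_prod_of_monic _ _ fun _ _ => Polynomial.monic_X_sub_C _

theorem coeff_rootPoly (p : F) (c l : ℕ) : (rootPoly p c l).coeff l = 1 := by
  have := (monic_rootPoly p c l).coeff_natDegree
  rwa [natDegree_rootPoly] at this

theorem eval_rootPoly (p : F) (c l : ℕ) (y : F) :
    (rootPoly p c l).eval y = ∏ t ∈ Finset.range l, (y - p ^ (c + t)) := by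
  simp [rootPoly, Polynomial.eval_prod]

theorem eval_rootPoly_pow_eq_zero (p : F) (c l e : ℕ) (h1 : c ≤ e) (h2 : e < c + l) :
    (rootPoly p c l).eval (p ^ e) = 0 := by
  rw [eval_rootPoly]
  refine Finset.prod_eq_zero (Finset.mem_range.mpr (show e - c < l by omega)) ?_
  rw [Nat.add_sub_cancel' h1, sub_self]

theorem eval_rootPoly_mul (p : F) (c l r : ℕ) (y : F) :
    (rootPoly p c l).eval y * (rootPoly p (c + l) r).eval y = (rootPoly p c (l + r)).eval y := by
  simp_rw [eval_rootPoly, Finset.prod_range_add, add_assoc]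

/-- Each factor is $-p^t(y-p^{c-t})$, and $c-t$ runs through $g,\dots,c$. -/
theorem prod_pow_sub_pow_mul (p : F) (g l c : ℕ) (hc : c + 1 = g + l) (y : F) :
    ∏ t ∈ Finset.range l, (p ^ c - p ^ t * y) =
      (∏ t ∈ Finset.range l, -p ^ t) * (rootPoly p g l).eval y := by
  rw [eval_rootPoly, ← Finset.prod_range_reflect (fun t => y - p ^ (g + t)),
    ← Finset.prod_mul_distrib]
  refine Finset.prod_congr rfl fun t ht => ?_
  rw [Finset.mem_range] at ht
  rw [show c = t + (g + (l - 1 - t)) by omega, pow_add]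
  ring

/-- Consecutive roots may be split off from either end. -/
theorem prod_consecutive (p : F) (c l r : ℕ) (hl : l ≤ c + 1) (y : F) :
    (∏ t ∈ Finset.range l, (p ^ c - p ^ t * y)) *
        ∏ t ∈ Finset.range r, (y - p ^ (t + 1) * p ^ c) =
      (rootPoly p (c + 1 - l) r).eval y * ∏ t ∈ Finset.range l, (p ^ (c + r) - p ^ t * y) := by
  obtain ⟨g, hg⟩ : ∃ g, c + 1 = g + l := ⟨c + 1 - l, by omega⟩
  rw [prod_pow_sub_pow_mul p g l c hg, prod_pow_sub_pow_mul p (g + r) l (c + r) (by omega),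
    show c + 1 - l = g by omega]
  have h1 : ∏ t ∈ Finset.range r, (y - p ^ (t + 1) * p ^ c) = (rootPoly p (g + l) r).eval y := by
    rw [eval_rootPoly]
    refine Finset.prod_congr rfl fun t _ => ?_
    rw [← pow_add, show t + 1 + c = g + l + t by omega]
  -- Up to the common factor $\prod(-p^t)$, both sides have the same $l+r$ consecutive roots
  -- starting at $p^g$.
  rw [h1, mul_assoc, eval_rootPoly_mul, mul_left_comm, eval_rootPoly_mul, add_comm l r]

end Consecutive

/-! ### Splitting off one variable -/

section Peel

variable {ι F : Type*} [Fintype ι] [LinearOrder ι] [Field F] {p : F}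

/-- If a grid function is supported on `α k = N`, where it is a multiple of a product of the Dyson
product over `s` and polynomials in the single variables, its weighted sum is a multiple of the
central coefficient of the Dyson product over `s`. -/
theorem gridSum_eq_mul_central_coeff (hp : Function.Injective fun j : ℕ => p ^ j) (a : ι → ℕ)
    (s : Finset ι) (k : ι) (hk : k ∉ s) (N : ℕ) (A : ι → Finset ℕ)
    (hAk : A k = Finset.range (N + 1))
    (hA : ∀ i, i ≠ k → (A i).card = centralDegree a s i + (if i ∈ s then a k else 0) + 1)
    (P : ι → Polynomial F) (hP : ∀ i ∈ s, (P i).natDegree ≤ a k) (f : (ι → ℕ) → F) (c : F)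
    (h0 : ∀ α, (∀ i, α i ∈ A i) → α k ≠ N → f α = 0)
    (h1 : ∀ α, (∀ i, α i ∈ A i) → α k = N →
      f α = c * (MvPolynomial.eval (fun i => p ^ α i) (dysonPoly p a s) *
        ∏ i ∈ s, (P i).eval (p ^ α i))) :
    gridSum p A f = nodeWeight p (Finset.range (N + 1)) N * c * (∏ i ∈ s, (P i).coeff (a k)) *
      (dysonPoly p a s).coeff (Finsupp.equivFunOnFinite.symm (centralDegree a s)) := by
  have hN : N ∈ A k := by rw [hAk]; simp
  set d : ι →₀ ℕ := Finsupp.equivFunOnFinite.symm (centralDegree a s) with hd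
  have hdi : ∀ i, d i = centralDegree a s i := fun i => rfl
  have hsum : ∀ i, (∑ j ∈ s, Finsupp.single j (a k)) i = if i ∈ s then a k else 0 := by
    intro i
    simp [Finsupp.finsetSum_apply, Finsupp.single_apply]
  have hdeg : (dysonPoly p a s).totalDegree ≤ d.degree := by
    rw [Finsupp.degree_eq_sum]
    exact (isHomogeneous_dysonPoly p a s).totalDegree_le
  rw [gridSum_eq_of_support p A f k N hN h0, hAk, mul_assoc, mul_assoc,
    ← coeff_mul_prod_aeval_X (dysonPoly p a s) d hdeg s P (fun _ => a k) hP]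
  congr 1
  -- Interpolation read backwards: the remaining polynomial has target exponent $0$ in $x_k$, so one
  -- node suffices in that direction.
  rw [coeff_eq_gridSum hp (Function.update A k {N}), ← gridSum_const_mul]
  · refine gridSum_congr _ _ fun α hα => ?_
    have hα' : ∀ i, α i ∈ A i := by
      intro i
      by_cases hi : i = k
      · subst hi
        have := hα i
        rw [Function.update_self, Finset.mem_singleton] at this
        rwa [this]
      · simpa [hi] using hα i
    rw [h1 α hα' (by simpa using hα k), map_mul, map_prod]
    congr 2
    refine Finset.prod_congr rfl fun i _ => ?_
    rw [← MvPolynomial.coe_aeval_eq_eval, RingHom.coe_coe, ← Polynomial.aeval_algHom_apply,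
      MvPolynomial.aeval_X, Polynomial.coe_aeval_eq_eval]
  · intro i
    rw [Finsupp.add_apply, hsum, hdi]
    by_cases hi : i = k
    · subst hi
      simp [centralDegree, hk]
    · rw [Function.update_of_ne hi, hA i hi]
  · refine (totalDegree_mul_prod_aeval_X_le _ s _ hdeg P (fun _ => a k) hP).trans (le_of_eq ?_)
    rw [← Finsupp.degree_eq_sum, map_add, map_sum]
    simp

/-- The `q`-Dyson theorem, one variable at a time. -/
theorem central_coeff_insert_max (hp : Function.Injective fun j : ℕ => p ^ j) (a : ι → ℕ)
    (s : Finset ι) (k : ι) (hk : ∀ i ∈ s, i < k) :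
    (dysonPoly p a (insert k s)).coeff
        (Finsupp.equivFunOnFinite.symm (centralDegree a (insert k s))) =
      nodeWeight p (Finset.range (∑ i ∈ s, a i + 1)) (∑ i ∈ s, a i) *
        (∏ l ∈ Finset.range (∑ i ∈ s, a i), (p ^ (∑ i ∈ s, a i + a k) - p ^ l)) *
        (dysonPoly p a s).coeff (Finsupp.equivFunOnFinite.symm (centralDegree a s)) := by
  have hks : k ∉ s := fun h => lt_irrefl k (hk k h)
  set N := ∑ i ∈ s, a i with hN
  have hdk : centralDegree a (insert k s) k = N := centralDegree_insert_self a s k hks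
  have hdi : ∀ i ∈ s, centralDegree a (insert k s) i + a i = N + a k := by
    intro i hi
    rw [centralDegree_add a _ i (Finset.mem_insert_of_mem hi), Finset.sum_insert hks, add_comm]
  rw [coeff_eq_gridSum hp (fun i => Finset.range (centralDegree a (insert k s) i + 1))
    _ (fun i => by simp) _ (isHomogeneous_dysonPoly p a (insert k s)).totalDegree_le,
    gridSum_eq_mul_central_coeff hp a s k hks N _ (by rw [hdk]) (fun i hi => by
      rw [Finset.card_range, centralDegree_insert_of_ne a s k i hks hi])
      (fun i => rootPoly p (N + 1 - a i) (a k)) (fun i _ => (natDegree_rootPoly p _ _).le) _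
      (∏ l ∈ Finset.range N, (p ^ (N + a k) - p ^ l))]
  · simp [coeff_rootPoly]
  · intro α hα hαk
    simp only [Finset.mem_range, Nat.lt_succ_iff] at hα
    by_contra hne
    have hlt : α k < N := lt_of_le_of_ne (hdk ▸ hα k) hαk
    have hdisj := pairwiseDisjoint_of_eval_dysonPoly_ne_zero a α _ hne
    have hsub : letterExponents a α (insert k s) ⊆ Finset.range (N + a k) := by
      refine letterExponents_subset_range a α _ _ fun i hi _ => ?_
      rcases Finset.mem_insert.mp hi with rfl | hi
      · omega
      · have := hα i
        have := hdi i hi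
        omega
    -- By cardinality the intervals tile $[0,N+a_k)$, so some interval covers the point
    -- $\alpha_k+a_k$. It belongs to an index below $k$, where both overlap and adjacency are
    -- excluded; this is why $k$ is taken maximal.
    have heq := Finset.eq_of_subset_of_card_le hsub (by
      rw [card_letterExponents a α _ hdisj, Finset.card_range, Finset.sum_insert hks, add_comm])
    have hmem : α k + a k ∈ letterExponents a α (insert k s) := by
      rw [heq, Finset.mem_range]; omega
    obtain ⟨i, hi, hmem⟩ := Finset.mem_biUnion.mp hmem
    rw [Finset.mem_Ico] at hmem
    rcases Finset.mem_insert.mp hi with rfl | his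
    · omega
    · have := eval_dysonPoly_ne_zero a α _ hne i k hi (Finset.mem_insert_self k s) (hk i his)
      omega
  · intro α hα hαk
    simp only [Finset.mem_range, Nat.lt_succ_iff] at hα
    have hcross : ∀ i ∈ s, MvPolynomial.eval (fun i => p ^ α i)
        (if i < k then pairPoly p a i k else pairPoly p a k i) =
          (rootPoly p (N + 1 - a i) (a k)).eval (p ^ α i) *
            ∏ t ∈ Finset.range (a i), (p ^ (N + a k) - p ^ (α i + t)) := by
      intro i hi
      have hle : a i ≤ N := Finset.single_le_sum (f := a) (fun _ _ => Nat.zero_le _) hi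
      rw [if_pos (hk i hi), eval_pairPoly, hαk, prod_consecutive p N (a i) (a k) (by omega)]
      simp_rw [pow_add p (α i), mul_comm (p ^ α i)]
    rw [dysonPoly_insert p a s k hks, map_mul, map_prod, Finset.prod_congr rfl hcross,
      Finset.prod_mul_distrib, ← mul_assoc, mul_comm]
    by_cases hzero : MvPolynomial.eval (fun i => p ^ α i) (dysonPoly p a s) *
        ∏ i ∈ s, (rootPoly p (N + 1 - a i) (a k)).eval (p ^ α i) = 0
    · rw [hzero, mul_zero, mul_zero]
    · congr 1
      have hdisj := pairwiseDisjoint_of_eval_dysonPoly_ne_zero a α s (left_ne_zero_of_mul hzero)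
      have hroot := Finset.prod_ne_zero_iff.mp (right_ne_zero_of_mul hzero)
      -- The roots of `rootPoly` exclude $N<\alpha_i+a_i\le N+a_k$. The intervals therefore tile
      -- $[0,N)$ exactly, and the product over their letters is constant.
      have hsub : letterExponents a α s ⊆ Finset.range N := by
        refine letterExponents_subset_range a α _ _ fun i hi _ => ?_
        by_contra! hlt
        have := hα i
        have := hdi i hi
        exact hroot i hi (eval_rootPoly_pow_eq_zero p _ _ _ (by omega) (by omega))
      have heq := Finset.eq_of_subset_of_card_le hsub (by
        rw [card_letterExponents a α _ hdisj, Finset.card_range])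
      rw [← prod_letterExponents a α s hdisj fun l => p ^ (N + a k) - p ^ l, heq]

end Peel

/-! ### Shifted factorials -/

section Poch

variable {F : Type*} [Field F] {p : F}

theorem qPoch_add (r N : ℕ) : qPoch p p (r + N) = qPoch p p r * qPoch p (p ^ (r + 1)) N := by
  unfold qPoch
  rw [Finset.prod_range_add]
  congr 1
  refine Finset.prod_congr rfl fun t _ => ?_
  rw [← pow_succ', ← pow_add, show r + t + 1 = r + 1 + t by omega]

theorem qPoch_succ (r : ℕ) : qPoch p p (r + 1) = qPoch p p r * (1 - p ^ (r + 1)) := by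
  rw [qPoch_add]
  simp [qPoch]

theorem one_sub_pow_ne_zero (hp : Function.Injective fun j : ℕ => p ^ j) (r : ℕ) (hr : r ≠ 0) :
    1 - p ^ r ≠ 0 := by
  intro h
  refine hr (hp ?_)
  simp only [pow_zero]
  linear_combination -h

theorem qPoch_pow_ne_zero (hp : Function.Injective fun j : ℕ => p ^ j) (r N : ℕ) :
    qPoch p (p ^ (r + 1)) N ≠ 0 := by
  refine Finset.prod_ne_zero_iff.mpr fun t _ => ?_
  rw [← pow_add]
  exact one_sub_pow_ne_zero hp _ (by omega)

theorem qPoch_ne_zero (hp : Function.Injective fun j : ℕ => p ^ j) (N : ℕ) :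
    qPoch p p N ≠ 0 := by
  simpa using qPoch_pow_ne_zero hp 0 N

theorem prod_pow_sub_pow (N r : ℕ) :
    ∏ l ∈ Finset.range N, (p ^ (N + r) - p ^ l) =
      (∏ l ∈ Finset.range N, -p ^ l) * qPoch p (p ^ (r + 1)) N := by
  rw [qPoch, ← Finset.prod_range_reflect (fun t => 1 - p ^ (r + 1) * p ^ t),
    ← Finset.prod_mul_distrib]
  refine Finset.prod_congr rfl fun l hl => ?_
  rw [Finset.mem_range] at hl
  rw [← pow_add, show N + r = l + (r + 1 + (N - 1 - l)) by omega, pow_add]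
  ring

/-- The node weight is the inverse of the same product at $r=0$, so signs and powers of $p$ cancel.
-/
theorem nodeWeight_mul_prod (hp : Function.Injective fun j : ℕ => p ^ j) (N r : ℕ) :
    nodeWeight p (Finset.range (N + 1)) N *
        ∏ l ∈ Finset.range N, (p ^ (N + r) - p ^ l) =
      qPoch p p (N + r) / (qPoch p p N * qPoch p p r) := by
  have herase : (Finset.range (N + 1)).erase N = Finset.range N := by
    rw [Finset.range_add_one, Finset.erase_insert (by simp)]
  have h0 := prod_pow_sub_pow (p := p) N 0
  rw [add_zero, zero_add, pow_one] at h0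
  have hne : (∏ l ∈ Finset.range N, -p ^ l) ≠ 0 := by
    intro hz
    rw [hz, zero_mul] at h0
    obtain ⟨l, hl, h⟩ := Finset.prod_eq_zero_iff.mp h0
    rw [Finset.mem_range] at hl
    exact hl.ne' (hp (sub_eq_zero.mp h))
  rw [nodeWeight, herase, Finset.prod_inv_distrib, h0, prod_pow_sub_pow, add_comm N r, qPoch_add]
  have h1 := qPoch_ne_zero hp N
  have h2 := qPoch_ne_zero hp r
  field_simp

end Poch

/-! ### Factors linking the distinguished variable to the others -/

section CrossFactor

variable {ι F : Type*} [LinearOrder ι] [Field F] {p : F}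

/-- The single-variable factor left over from the pair `i`, `k` when `x_k = p ^ N`. -/
noncomputable def crossFactor (p : F) (a : ι → ℕ) (k : ι) (N r : ℕ) (i : ι) : Polynomial F :=
  if i < k then (Polynomial.X - Polynomial.C (p ^ (N + r + 1))) * rootPoly p (N + 1 - a i) r
  else Polynomial.C (p ^ a i) * rootPoly p (N - a i) (r + 1)

theorem natDegree_crossFactor_le (a : ι → ℕ) (k : ι) (N r : ℕ) (i : ι) :
    (crossFactor p a k N r i).natDegree ≤ r + 1 := by
  unfold crossFactor
  split_ifs
  · refine Polynomial.natDegree_mul_le.trans ?_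
    rw [Polynomial.natDegree_X_sub_C, natDegree_rootPoly, add_comm]
  · exact (Polynomial.natDegree_C_mul_le _ _).trans (natDegree_rootPoly p _ _).le

theorem coeff_crossFactor (a : ι → ℕ) (k : ι) (N r : ℕ) (i : ι) :
    (crossFactor p a k N r i).coeff (r + 1) = if i < k then 1 else p ^ a i := by
  unfold crossFactor
  split_ifs
  · have h : ((Polynomial.X - Polynomial.C (p ^ (N + r + 1))) * rootPoly p (N + 1 - a i) r).Monic :=
      (Polynomial.monic_X_sub_C _).mul (monic_rootPoly p _ _)
    have hd := (Polynomial.monic_X_sub_C (p ^ (N + r + 1))).natDegree_mul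
      (monic_rootPoly p (N + 1 - a i) r)
    rw [Polynomial.natDegree_X_sub_C, natDegree_rootPoly, add_comm 1] at hd
    rw [← hd]
    exact h.coeff_natDegree
  · rw [Polynomial.coeff_C_mul, coeff_rootPoly, mul_one]

/-- The product is shifted to end at $p^{N+r}$, the extra letter $p^M$ of the evaluation of $h_m$.
For $i<k$ this uses $r$ of the $r+1$ factors and leaves a linear one; for $i>k$ extracting $p^{a_i}$
lowers the start to $p^{N-1}$ and all $r+1$ factors are used. -/
theorem eval_crossFactor_mul (a : ι → ℕ) (k i : ι) (N r : ℕ) (hr : a k = r + 1) (hi : a i < N)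
    (y : ι → F) (hy : y k = p ^ N) :
    MvPolynomial.eval y (if i < k then pairPoly p a i k else pairPoly p a k i) =
      (crossFactor p a k N r i).eval (y i) *
        ∏ t ∈ Finset.range (a i), (p ^ (N + r) - p ^ t * y i) := by
  unfold crossFactor
  split_ifs
  · rw [eval_pairPoly, hy, hr, Finset.prod_range_succ, ← mul_assoc,
      prod_consecutive p N (a i) r (by omega), Polynomial.eval_mul, Polynomial.eval_sub,
      Polynomial.eval_X, Polynomial.eval_C, ← pow_add, show r + 1 + N = N + r + 1 by omega]
    ring
  · obtain ⟨c, rfl⟩ : ∃ c, N = c + 1 := ⟨N - 1, by omega⟩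
    have h := prod_consecutive p c (a i) (r + 1) (by omega) (y i)
    have h1 : ∏ t ∈ Finset.range (a i), (p ^ (c + 1) - p ^ (t + 1) * y i) =
        p ^ a i * ∏ t ∈ Finset.range (a i), (p ^ c - p ^ t * y i) := by
      rw [← Finset.card_range (a i), ← Finset.prod_const, Finset.card_range,
        ← Finset.prod_mul_distrib]
      exact Finset.prod_congr rfl fun t _ => by ring
    have h2 : ∏ t ∈ Finset.range (r + 1), (y i - p ^ t * p ^ (c + 1)) =
        ∏ t ∈ Finset.range (r + 1), (y i - p ^ (t + 1) * p ^ c) :=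
      Finset.prod_congr rfl fun t _ => by ring
    rw [eval_pairPoly, hy, hr, h1, h2, mul_left_comm, mul_comm (∏ t ∈ Finset.range (r + 1), _), h,
      Polynomial.eval_mul, Polynomial.eval_C, show c + (r + 1) = c + 1 + r by omega]
    ring

theorem eval_crossFactor_pow_eq_zero (a : ι → ℕ) (k i : ι) (N r e : ℕ) (hi : a i < N)
    (h1 : N < e + a i) (h2 : e + a i ≤ N + r) :
    (crossFactor p a k N r i).eval (p ^ e) = 0 := by
  unfold crossFactor
  split_ifs
  · rw [Polynomial.eval_mul, eval_rootPoly_pow_eq_zero p _ _ _ (by omega) (by omega), mul_zero]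
  · rw [Polynomial.eval_mul, eval_rootPoly_pow_eq_zero p _ _ _ (by omega) (by omega), mul_zero]

end CrossFactor

/-! ### The letters of $x^{(a)}$ and their specialisation -/

section Letters

open MvPolynomial (X C)

variable {ι F : Type*} [Fintype ι] [Field F]

/-- The letters `x_i p ^ j`, `0 ≤ j < a i`. -/
noncomputable def letterPoly (p : F) (a : ι → ℕ) (s : Σ i : ι, Fin (a i)) : MvPolynomial ι F :=
  X s.1 * C (p ^ (s.2 : ℕ))

theorem isHomogeneous_completeSum_letterPoly [DecidableEq ι] (p : F) (a : ι → ℕ) (m : ℕ) :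
    (completeSum (letterPoly p a) m).IsHomogeneous m := by
  have h : ∀ S : Multiset (Σ i : ι, Fin (a i)),
      ((S.map (letterPoly p a)).prod).IsHomogeneous S.card := by
    intro S
    induction S using Multiset.induction_on with
    | empty => simpa using MvPolynomial.isHomogeneous_one ι F
    | cons s S ih =>
      rw [Multiset.map_cons, Multiset.prod_cons, Multiset.card_cons, add_comm]
      refine MvPolynomial.IsHomogeneous.mul ?_ ih
      exact (MvPolynomial.isHomogeneous_X F s.1).mul (MvPolynomial.isHomogeneous_C ι _)
  refine MvPolynomial.IsHomogeneous.sum _ _ _ fun s _ => ?_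
  have := h s.1
  rwa [s.2] at this

theorem prod_one_sub_letters (p : F) (a α : ι → ℕ)
    (h : ((Finset.univ : Finset ι) : Set ι).PairwiseDisjoint
      fun i => Finset.Ico (α i) (α i + a i)) :
    ∏ s : Σ i : ι, Fin (a i), (1 - PowerSeries.C (p ^ (α s.1 + s.2)) * PowerSeries.X) =
      eulerSeries p (letterExponents a α Finset.univ) := by
  rw [eulerSeries, prod_letterExponents a α _ h, Fintype.prod_sigma]
  refine Finset.prod_congr rfl fun i _ => ?_
  rw [Finset.prod_range]

end Letters

/-! ### The $q$-Dyson theorem and the coefficients with $h_m$ -/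

section Evaluation

open MvPolynomial (X C)

variable {ι F : Type*} [Fintype ι] [LinearOrder ι] [Field F] {p : F}

/-- The `q`-Dyson theorem. -/
theorem central_coeff_dysonPoly (hp : Function.Injective fun j : ℕ => p ^ j) (a : ι → ℕ)
    (s : Finset ι) :
    (dysonPoly p a s).coeff (Finsupp.equivFunOnFinite.symm (centralDegree a s)) =
      qPoch p p (∑ i ∈ s, a i) / ∏ i ∈ s, qPoch p p (a i) := by
  induction s using Finset.induction_on_max with
  | empty =>
    have : Finsupp.equivFunOnFinite.symm (centralDegree a ∅) = 0 := by
      ext i; simp [centralDegree]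
    rw [this]
    simp [dysonPoly, qPoch]
  | insert k s hk ih =>
    have hks : k ∉ s := fun h => lt_irrefl k (hk k h)
    rw [central_coeff_insert_max hp a s k hk, ih, nodeWeight_mul_prod hp, Finset.sum_insert hks,
      Finset.prod_insert hks, add_comm (a k)]
    have h1 := qPoch_ne_zero hp (∑ i ∈ s, a i)
    field_simp

/-- The coefficient of `h_m(x^{(a)})` times the Dyson product, by interpolation of
`h_m(x^{(a)} - Y)` times the Dyson product, where `Y` consists of the first `M` powers of `p`. -/
theorem coeff_complete_mul_dysonPoly (hp : Function.Injective fun j : ℕ => p ^ j) (a : ι → ℕ)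
    (m M : ℕ) (d : ι →₀ ℕ) (hd : ∑ i, d i = m + ∑ i, centralDegree a Finset.univ i) :
    (completeSum (letterPoly p a) m * dysonPoly p a Finset.univ).coeff d =
      gridSum p (fun i => Finset.range (d i + 1)) fun α =>
        PowerSeries.coeff m (eulerSeries p (Finset.range M) *
          PowerSeries.mk (completeSum fun s : Σ i : ι, Fin (a i) => p ^ (α s.1 + s.2))) *
        MvPolynomial.eval (fun i => p ^ α i) (dysonPoly p a Finset.univ) := by
  set Q : MvPolynomial ι F := ∑ j ∈ Finset.range (m + 1),
    C (PowerSeries.coeff j (eulerSeries p (Finset.range M))) *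
      completeSum (letterPoly p a) (m - j) with hQ
  have hdyson : (dysonPoly p a Finset.univ).totalDegree ≤ ∑ i, centralDegree a Finset.univ i :=
    (isHomogeneous_dysonPoly p a Finset.univ).totalDegree_le
  have hterm : ∀ j, (C (PowerSeries.coeff j (eulerSeries p (Finset.range M))) *
      completeSum (letterPoly p a) (m - j)).totalDegree ≤ m - j := by
    intro j
    refine (MvPolynomial.totalDegree_mul _ _).trans ?_
    rw [MvPolynomial.totalDegree_C, zero_add]
    exact (isHomogeneous_completeSum_letterPoly p a (m - j)).totalDegree_le
  -- The correction terms $j\ge1$ have total degree below that of $x^d$, and the term $j=0$ has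
  -- coefficient $1$.
  have hcoeff : (completeSum (letterPoly p a) m * dysonPoly p a Finset.univ).coeff d =
      (Q * dysonPoly p a Finset.univ).coeff d := by
    have h0 : PowerSeries.coeff 0 (eulerSeries p (Finset.range M)) = 1 := by
      simp [eulerSeries, map_prod]
    rw [hQ, Finset.sum_range_succ', h0, map_one, one_mul, Nat.sub_zero, add_mul,
      MvPolynomial.coeff_add, Finset.sum_mul, MvPolynomial.coeff_sum]
    rw [Finset.sum_eq_zero, zero_add]
    intro j hj
    rw [Finset.mem_range] at hj
    refine MvPolynomial.coeff_eq_zero_of_totalDegree_lt ?_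
    change _ < d.degree
    rw [Finsupp.degree_eq_sum, hd]
    have := (MvPolynomial.totalDegree_mul _ _).trans (add_le_add (hterm (j + 1)) hdyson)
    omega
  have hdeg : (Q * dysonPoly p a Finset.univ).totalDegree ≤ ∑ i, d i := by
    rw [hd]
    refine (MvPolynomial.totalDegree_mul _ _).trans (add_le_add ?_ hdyson)
    exact MvPolynomial.totalDegree_finsetSum_le fun j _ => (hterm j).trans (Nat.sub_le _ _)
  rw [hcoeff, coeff_eq_gridSum hp (fun i => Finset.range (d i + 1)) d (fun i => by simp) _ hdeg]
  refine gridSum_congr _ _ fun α _ => ?_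
  rw [map_mul]
  congr 1
  rw [PowerSeries.coeff_mul, Finset.Nat.sum_antidiagonal_eq_sum_range_succ_mk, hQ, map_sum]
  refine Finset.sum_congr rfl fun j _ => ?_
  rw [map_mul, MvPolynomial.eval_C, map_completeSum, PowerSeries.coeff_mk]
  simp [letterPoly, pow_add]

theorem coeff_complete_mul_dysonPoly_eq_zero (hp : Function.Injective fun j : ℕ => p ^ j)
    (a v : ι → ℕ) (m : ℕ) (hm : 0 < m) (hv : ∑ i, v i = m) (hlt : ∀ i, 0 < a i → v i < m) :
    (completeSum (letterPoly p a) m * dysonPoly p a Finset.univ).coeff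
      (Finsupp.equivFunOnFinite.symm fun i => centralDegree a Finset.univ i + v i) = 0 := by
  -- $M=|a|+m-1$ is the largest value with $M<m+|a|$. It also bounds $\alpha_i+a_i\le|a|+v_i$
  -- whenever $a_i>0$.
  rw [coeff_complete_mul_dysonPoly hp a m (∑ i, a i + m - 1) _ (by
    simp [Finset.sum_add_distrib, hv, add_comm])]
  refine gridSum_eq_zero _ _ fun α hα => ?_
  by_cases hne : MvPolynomial.eval (fun i => p ^ α i) (dysonPoly p a Finset.univ) = 0
  · rw [hne, mul_zero]
  have hdisj := pairwiseDisjoint_of_eval_dysonPoly_ne_zero a α _ hne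
  rw [coeff_eulerSeries_mul_complete_eq_zero p _ (letterExponents a α Finset.univ) _ m
    (prod_one_sub_letters p a α hdisj), zero_mul]
  · refine letterExponents_subset_range a α _ _ fun i hi hai => ?_
    have h1 : α i < centralDegree a Finset.univ i + v i + 1 := Finset.mem_range.mp (hα i)
    have h2 := centralDegree_add a Finset.univ i hi
    have h3 := hlt i hai
    omega
  · rw [card_letterExponents a α _ hdisj]
    omega

theorem coeff_complete_mul_dysonPoly_single (hp : Function.Injective fun j : ℕ => p ^ j)
    (a : ι → ℕ) (k : ι) (m b r : ℕ) (hm : 0 < m) (hr : a k = r + 1)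
    (hb : ∑ i ∈ Finset.univ.erase k, a i = b) :
    (completeSum (letterPoly p a) m * dysonPoly p a Finset.univ).coeff
        (Finsupp.equivFunOnFinite.symm fun i =>
          centralDegree a Finset.univ i + (Pi.single k m : ι → ℕ) i) =
      qPoch p p (b + m + r) / (qPoch p p (b + m) * qPoch p p r) *
        (∏ i ∈ Finset.univ.erase k, if i < k then 1 else p ^ a i) *
        (qPoch p p b / ∏ i ∈ Finset.univ.erase k, qPoch p p (a i)) := by
  have hks : k ∉ Finset.univ.erase k := Finset.notMem_erase k _
  have hins : insert k (Finset.univ.erase k) = Finset.univ :=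
    Finset.insert_erase (Finset.mem_univ k)
  have htot : ∑ i, a i = b + (r + 1) := by
    rw [← Finset.sum_erase_add _ _ (Finset.mem_univ k), hb, hr]
  have hdk : centralDegree a Finset.univ k = b := by
    rw [← hb, ← centralDegree_insert_self a _ k hks, hins]
  have hdi : ∀ i, centralDegree a Finset.univ i + a i = b + (r + 1) := fun i => by
    rw [centralDegree_add a _ i (Finset.mem_univ i), htot]
  have hai : ∀ i ∈ Finset.univ.erase k, a i < b + m := by
    intro i hi
    have : a i ≤ b := hb ▸ Finset.single_le_sum (f := a) (fun _ _ => Nat.zero_le _) hi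
    omega
  -- Again $M=|a|+m-1$, as $|a|=b+r+1$. The last node in direction $k$ is $N=b+m$, and only there
  -- does the interval of $k$ leave $[0,M)$.
  rw [coeff_complete_mul_dysonPoly hp a m (b + m + r) _ (by
      simp [Finset.sum_add_distrib, add_comm]),
    gridSum_eq_mul_central_coeff hp a (Finset.univ.erase k) k hks (b + m) _ (by
      simp [hdk]) (fun i hi => by
      have := centralDegree_insert_of_ne a _ k i hks hi
      rw [hins] at this
      simp [this, hi]) (crossFactor p a k (b + m) r)
      (fun i _ => hr ▸ natDegree_crossFactor_le a k _ r i) _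
      (∏ l ∈ Finset.range (b + m), (p ^ (b + m + r) - p ^ l)),
    nodeWeight_mul_prod hp, central_coeff_dysonPoly hp, hb, hr]
  · simp_rw [coeff_crossFactor]
  · intro α hα hαk
    have hα' : ∀ i, α i ≤ centralDegree a Finset.univ i + (Pi.single k m : ι → ℕ) i :=
      fun i => Nat.lt_succ_iff.mp (Finset.mem_range.mp (hα i))
    by_cases hne : MvPolynomial.eval (fun i => p ^ α i) (dysonPoly p a Finset.univ) = 0
    · rw [hne, mul_zero]
    have hdisj := pairwiseDisjoint_of_eval_dysonPoly_ne_zero a α _ hne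
    rw [coeff_eulerSeries_mul_complete_eq_zero p _ (letterExponents a α Finset.univ) _ m
      (prod_one_sub_letters p a α hdisj), zero_mul]
    · refine letterExponents_subset_range a α _ _ fun i _ _ => ?_
      have h1 := hα' i
      have h2 := hdi i
      by_cases hi : i = k
      · subst hi
        rw [Pi.single_eq_same] at h1
        omega
      · rw [Pi.single_eq_of_ne hi] at h1
        omega
    · rw [card_letterExponents a α _ hdisj]
      omega
  · intro α hα hαk
    have hα' : ∀ i ∈ Finset.univ.erase k, α i + a i ≤ b + (r + 1) := by
      intro i hi
      have h1 := Finset.mem_range.mp (hα i)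
      have h2 := hdi i
      simp only [Finsupp.equivFunOnFinite_symm_apply_apply,
        Pi.single_eq_of_ne (Finset.ne_of_mem_erase hi)] at h1
      omega
    have hcross : ∀ i ∈ Finset.univ.erase k, MvPolynomial.eval (fun i => p ^ α i)
        (if i < k then pairPoly p a i k else pairPoly p a k i) =
          (crossFactor p a k (b + m) r i).eval (p ^ α i) *
            ∏ t ∈ Finset.range (a i), (p ^ (b + m + r) - p ^ (α i + t)) := by
      intro i hi
      rw [eval_crossFactor_mul a k i (b + m) r hr (hai i hi) _ (by rw [hαk])]
      simp_rw [pow_add p (α i), mul_comm (p ^ α i)]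
    have hdyson : MvPolynomial.eval (fun i => p ^ α i) (dysonPoly p a Finset.univ) =
        MvPolynomial.eval (fun i => p ^ α i) (dysonPoly p a (Finset.univ.erase k)) *
          (∏ i ∈ Finset.univ.erase k, (crossFactor p a k (b + m) r i).eval (p ^ α i)) *
          ∏ i ∈ Finset.univ.erase k, ∏ t ∈ Finset.range (a i),
            (p ^ (b + m + r) - p ^ (α i + t)) := by
      conv_lhs => rw [← hins]
      rw [dysonPoly_insert p a _ k hks, map_mul, map_prod, Finset.prod_congr rfl hcross,
        Finset.prod_mul_distrib, ← mul_assoc]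
    rw [hdyson, mul_left_comm, mul_comm (∏ l ∈ Finset.range (b + m), _)]
    by_cases hzero : MvPolynomial.eval (fun i => p ^ α i) (dysonPoly p a (Finset.univ.erase k)) *
        ∏ i ∈ Finset.univ.erase k, (crossFactor p a k (b + m) r i).eval (p ^ α i) = 0
    · rw [hzero, zero_mul, zero_mul]
    · congr 1
      have hdisj := pairwiseDisjoint_of_eval_dysonPoly_ne_zero a α _ (left_ne_zero_of_mul hzero)
      have hroot := Finset.prod_ne_zero_iff.mp (right_ne_zero_of_mul hzero)
      -- The roots of `crossFactor` exclude $N<\alpha_i+a_i\le N+r$, and the grid allows no larger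
      -- value since $|a|\le N+r$.
      have hle : ∀ i ∈ Finset.univ.erase k, α i + a i ≤ b + m := by
        intro i hi
        by_contra! hlt
        have := hα' i hi
        exact hroot i hi (eval_crossFactor_pow_eq_zero a k i _ _ _ (hai i hi) hlt (by omega))
      have hsub : letterExponents a α (Finset.univ.erase k) ⊆ Finset.range (b + m) :=
        letterExponents_subset_range a α _ _ fun i hi _ => hle i hi
      have hdisj' : ((Finset.univ : Finset ι) : Set ι).PairwiseDisjoint
          fun i => Finset.Ico (α i) (α i + a i) := by
        rw [← hins, Finset.coe_insert]
        refine hdisj.insert fun i hi _ => ?_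
        refine Finset.disjoint_left.mpr fun l hl hl' => ?_
        have := hle i hi
        rw [Finset.mem_Ico] at hl hl'
        omega
      have hU : letterExponents a α Finset.univ =
          Finset.Ico (b + m) (b + m + r + 1) ∪ letterExponents a α (Finset.univ.erase k) := by
        rw [← hins]
        simp only [letterExponents]
        rw [Finset.biUnion_insert, hαk, hr, hins]
        rfl
      -- The interval of $k$ fills $[N,M]$. Thus $h_m$ contributes the factors at the gaps in
      -- $[0,N)$, and the cross factors contribute those at the occupied places.
      have hdiff : Finset.range (b + m + r + 1) \ letterExponents a α Finset.univ =
          Finset.range (b + m) \ letterExponents a α (Finset.univ.erase k) := by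
        rw [hU]
        ext l
        simp only [Finset.mem_sdiff, Finset.mem_range, Finset.mem_union, Finset.mem_Ico]
        constructor
        · rintro ⟨h1, h2⟩
          exact ⟨by by_contra h; exact h2 (Or.inl ⟨by omega, h1⟩), fun h => h2 (Or.inr h)⟩
        · rintro ⟨h1, h2⟩
          exact ⟨by omega, fun h => h.elim (fun h => by omega) h2⟩
      have hval := coeff_eulerSeries_mul_complete p _ (letterExponents a α Finset.univ)
        (b + m + r) m (prod_one_sub_letters p a α hdisj') (by
          refine letterExponents_subset_range a α _ _ fun i _ _ => ?_
          by_cases hi : i = k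
          · subst hi; omega
          · have := hle i (Finset.mem_erase.mpr ⟨hi, Finset.mem_univ i⟩)
            omega) (by rw [card_letterExponents a α _ hdisj', htot]; omega)
      rw [hval, hdiff, ← prod_letterExponents a α _ hdisj fun l => p ^ (b + m + r) - p ^ l,
        Finset.prod_sdiff hsub]

end Evaluation

/-! ### From Laurent polynomials to polynomials -/

section Laurent

theorem q_pow_injective : Function.Injective fun j : ℕ => q ^ j := by
  intro i j hij
  have h : (algebraMap (Polynomial ℚ) (RatFunc ℚ)) (Polynomial.X ^ i) =
      (algebraMap (Polynomial ℚ) (RatFunc ℚ)) (Polynomial.X ^ j) := by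
    simpa [q] using hij
  have h' := congrArg Polynomial.natDegree (RatFunc.algebraMap_injective ℚ h)
  simpa using h'

variable {n : ℕ}

theorem mono_zero : (mono 0 : Laurent n) = 1 := rfl

theorem mono_mul (u v : Fin n → ℤ) : mono u * mono v = mono (u + v) := by
  simp [mono, AddMonoidAlgebra.single_mul_single]

theorem mono_pow (u : Fin n → ℤ) (k : ℕ) : mono u ^ k = mono (k • u) := by
  induction k with
  | zero => simp [mono_zero]
  | succ k ih => rw [pow_succ, ih, mono_mul, succ_nsmul]

theorem mono_sum {β : Type*} (s : Finset β) (u : β → Fin n → ℤ) :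
    ∏ i ∈ s, mono (u i) = mono (∑ i ∈ s, u i) := by
  classical
  induction s using Finset.induction_on with
  | empty => simp [mono_zero]
  | insert k s hk ih => rw [Finset.prod_insert hk, Finset.sum_insert hk, ih, mono_mul]

/-- The inclusion of polynomials into Laurent polynomials. -/
noncomputable def toLaurent (n : ℕ) : MvPolynomial (Fin n) K →ₐ[K] Laurent n :=
  MvPolynomial.aeval x

theorem toLaurent_X (i : Fin n) : toLaurent n (MvPolynomial.X i) = x i :=
  MvPolynomial.aeval_X _ _

theorem toLaurent_C (c : K) : toLaurent n (MvPolynomial.C c) = algebraMap K (Laurent n) c :=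
  MvPolynomial.aeval_C _ _

theorem toLaurent_monomial (e : Fin n →₀ ℕ) (c : K) :
    toLaurent n (MvPolynomial.monomial e c) = AddMonoidAlgebra.single (fun i => (e i : ℤ)) c := by
  have h : (e.prod fun i k => (x i : Laurent n) ^ k) = mono fun i => (e i : ℤ) := by
    rw [Finsupp.prod_fintype _ _ fun i => pow_zero _]
    simp_rw [x, mono_pow]
    rw [mono_sum]
    congr 1
    ext i
    simp [Finset.sum_apply, Pi.single_apply]
  rw [toLaurent, MvPolynomial.aeval_monomial, h, mono, ← Algebra.smul_def,
    AddMonoidAlgebra.smul_single, smul_eq_mul, mul_one]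

theorem coeff_toLaurent (P : MvPolynomial (Fin n) K) (d : Fin n →₀ ℕ) :
    (toLaurent n P).coeff (fun i => (d i : ℤ)) = P.coeff d := by
  classical
  induction P using MvPolynomial.induction_on' with
  | monomial e c =>
    rw [toLaurent_monomial, MvPolynomial.coeff_monomial, AddMonoidAlgebra.coeff_single,
      Finsupp.single_apply]
    have : (fun i => (e i : ℤ)) = (fun i => (d i : ℤ)) ↔ e = d := by
      constructor
      · intro h
        ext i
        exact_mod_cast congrFun h i
      · rintro rfl; rfl
    simp only [this]
  | add P Q hP hQ =>
    rw [map_add, MvPolynomial.coeff_add, ← hP, ← hQ]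
    rfl

theorem CT_mono_mul_toLaurent (d : Fin n →₀ ℕ) (P : MvPolynomial (Fin n) K) :
    CT (mono (fun i => -(d i : ℤ)) * toLaurent n P) = P.coeff d := by
  rw [CT, mono, AddMonoidAlgebra.coeff_single_mul_eq_mul_coeff (fun i => (d i : ℤ)), one_mul,
    coeff_toLaurent]
  intro u _
  constructor
  · intro h
    ext i
    have := congrFun h i
    simp only [Pi.add_apply, Pi.zero_apply] at this
    omega
  · rintro rfl
    ext i
    simp

theorem toLaurent_letterPoly (a : Fin n → ℕ) (s : Σ i : Fin n, Fin (a i)) :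
    toLaurent n (letterPoly q a s) = alphabet a s := by
  rw [letterPoly, map_mul, toLaurent_X, toLaurent_C, alphabet, qL, map_pow]

theorem hAlphabet_eq (a : Fin n → ℕ) (m : ℕ) :
    hAlphabet a m = toLaurent n (completeSum (letterPoly q a) m) := by
  rw [hAlphabet, aeval_hsymm, ← AlgHom.coe_toRingHom, map_completeSum]
  congr 1
  funext s
  exact (toLaurent_letterPoly a s).symm

theorem one_sub_ratio_mul (i j : Fin n) (c : K) :
    1 - ratio i j * algebraMap K (Laurent n) c =
      mono (-Pi.single j 1) * toLaurent n (MvPolynomial.X j - MvPolynomial.C c * MvPolynomial.X i) := by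
  rw [map_sub, map_mul, toLaurent_X, toLaurent_X, toLaurent_C, mul_sub, x, x, mono_mul,
    neg_add_cancel, mono_zero, mul_left_comm, mono_mul, ratio, neg_add_eq_sub, mul_comm]

theorem qPoch_mul_qPoch (a : Fin n → ℕ) (i j : Fin n) :
    qPoch (qL n) (ratio i j) (a i) * qPoch (qL n) (qL n * ratio j i) (a j) =
      mono (a i • -Pi.single j 1 + a j • -Pi.single i 1) * toLaurent n (pairPoly q a i j) := by
  have h1 : qPoch (qL n) (ratio i j) (a i) = mono (a i • -Pi.single j 1) * toLaurent n
      (∏ t ∈ Finset.range (a i),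
        (MvPolynomial.X j - MvPolynomial.C (q ^ t) * MvPolynomial.X i)) := by
    rw [← mono_pow, map_prod, ← Finset.card_range (a i), ← Finset.prod_const, Finset.card_range,
      ← Finset.prod_mul_distrib]
    refine Finset.prod_congr rfl fun t _ => ?_
    rw [qL, ← map_pow, one_sub_ratio_mul]
  have h2 : qPoch (qL n) (qL n * ratio j i) (a j) = mono (a j • -Pi.single i 1) * toLaurent n
      (∏ t ∈ Finset.range (a j),
        (MvPolynomial.X i - MvPolynomial.C (q ^ (t + 1)) * MvPolynomial.X j)) := by
    rw [← mono_pow, map_prod, ← Finset.card_range (a j), ← Finset.prod_const, Finset.card_range,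
      ← Finset.prod_mul_distrib]
    refine Finset.prod_congr rfl fun t _ => ?_
    rw [mul_comm (qL n), mul_assoc, ← pow_succ', qL, ← map_pow, one_sub_ratio_mul]
  rw [h1, h2, pairPoly, map_mul, ← mono_mul]
  ring

/-- Each pair contributes the denominators $x_j^{a_i}x_i^{a_j}$, so $x_l$ collects the exponent
$\sum_{i\ne l}a_i$. -/
theorem dyson_eq (a : Fin n → ℕ) :
    dyson a = mono (fun i => -(centralDegree a Finset.univ i : ℤ)) *
      toLaurent n (dysonPoly q a Finset.univ) := by
  have hIoi : ∀ i : Fin n, Finset.Ioi i = Finset.univ.filter (i < ·) := by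
    intro i; ext j; simp
  have hpoly : dysonPoly q a Finset.univ =
      ∏ i : Fin n, ∏ j ∈ Finset.Ioi i, pairPoly q a i j := by
    unfold dysonPoly
    refine Finset.prod_congr rfl fun i _ => ?_
    rw [hIoi, Finset.prod_filter]
  unfold dyson
  simp_rw [qPoch_mul_qPoch, Finset.prod_mul_distrib]
  rw [hpoly, map_prod]
  simp_rw [map_prod, mono_sum]
  congr 2
  ext l
  simp only [Finset.sum_apply, Pi.add_apply, Pi.smul_apply, Pi.neg_apply, Pi.single_apply]
  simp only [hIoi, Finset.sum_filter]
  have hsplit : ∀ i j : Fin n,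
      (if i < j then a i • -(if l = j then (1 : ℤ) else 0) + a j • -(if l = i then (1 : ℤ) else 0)
        else 0) =
      (if l = j then (if i < j then -(a i : ℤ) else 0) else 0) +
        if l = i then (if i < j then -(a j : ℤ) else 0) else 0 := by
    intro i j
    split_ifs <;> simp
  simp_rw [hsplit, Finset.sum_add_distrib]
  rw [Finset.sum_comm (f := fun i j => if l = i then (if i < j then -(a j : ℤ) else 0) else 0)]
  simp only [Finset.sum_ite_eq, Finset.mem_univ, if_true]
  rw [← Finset.sum_add_distrib, centralDegree, if_pos (Finset.mem_univ l), Nat.cast_sum,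
    ← Finset.sum_neg_distrib, ← Finset.filter_ne', Finset.sum_filter]
  refine Finset.sum_congr rfl fun i _ => ?_
  rcases lt_trichotomy i l with h | h | h
  · simp [h, h.ne, h.not_gt]
  · simp [h]
  · simp [h, h.ne', h.not_gt]

theorem D_eq_coeff (v a : Fin n → ℕ) (m : ℕ) :
    D v m a = (completeSum (letterPoly q a) m * dysonPoly q a Finset.univ).coeff
      (Finsupp.equivFunOnFinite.symm fun i => centralDegree a Finset.univ i + v i) := by
  have hmono : mono (fun i => -(v i : ℤ)) * mono (fun i => -(centralDegree a Finset.univ i : ℤ)) =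
      mono fun i => -((Finsupp.equivFunOnFinite.symm
        fun i => centralDegree a Finset.univ i + v i) i : ℤ) := by
    rw [mono_mul]
    congr 1
    ext i
    simp
  rw [D, hAlphabet_eq, dyson_eq, mul_mul_mul_comm, hmono, ← map_mul, CT_mono_mul_toLaurent]

end Laurent

/-! ### The evaluation -/

section Final

variable {n : ℕ}

theorem sortedParts_single (k : Fin n) (m : ℕ) (hm : 0 < m) :
    sortedParts (Pi.single k m : Fin n → ℕ) = [m] := by
  have h : ((Finset.univ : Finset (Fin n)).val.map (Pi.single k m : Fin n → ℕ)).filter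
      (fun p => p ≠ 0) = {m} := by
    rw [← Finset.insert_erase (Finset.mem_univ k),
      Finset.insert_val_of_notMem (Finset.notMem_erase k _), Multiset.map_cons,
      Pi.single_eq_same, Multiset.filter_cons_of_pos (p := fun p => p ≠ 0) _ hm.ne']
    have : (((Finset.univ : Finset (Fin n)).erase k).val.map (Pi.single k m : Fin n → ℕ)).filter
        (fun p => p ≠ 0) = 0 := by
      rw [Multiset.filter_eq_nil]
      intro p hp
      obtain ⟨i, hi, rfl⟩ := Multiset.mem_map.mp hp
      rw [Pi.single_eq_of_ne (Finset.ne_of_mem_erase (Finset.mem_def.mpr hi))]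
      simp
    rw [this]
    rfl
  rw [sortedParts, h, Multiset.sort_singleton]

theorem eq_single_of_le (v : Fin n → ℕ) (m : ℕ) (hv : ∑ i, v i = m) (k : Fin n) (hk : m ≤ v k) :
    v = Pi.single k m := by
  rw [← Finset.add_sum_erase _ _ (Finset.mem_univ k)] at hv
  have h0 : ∑ i ∈ Finset.univ.erase k, v i = 0 := by omega
  funext i
  by_cases hi : i = k
  · subst hi
    rw [Pi.single_eq_same]
    omega
  · rw [Pi.single_eq_of_ne hi]
    exact Finset.sum_eq_zero_iff.mp h0 i (Finset.mem_erase.mpr ⟨hi, Finset.mem_univ i⟩)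

theorem D_eq_zero_of_sum_ne (v a : Fin n → ℕ) (m : ℕ) (hv : ∑ i, v i ≠ m) : D v m a = 0 := by
  rw [D_eq_coeff]
  refine ((isHomogeneous_completeSum_letterPoly q a m).mul
    (isHomogeneous_dysonPoly q a Finset.univ)).coeff_eq_zero ?_
  rw [Finsupp.degree_eq_sum]
  simp only [Finsupp.equivFunOnFinite_symm_apply_apply, Finset.sum_add_distrib]
  omega

/-- The source of $q^{\sigma_n-\sigma_k}$: only the cross factors with $i>k$ have a leading
coefficient other than $1$. -/
theorem prod_ite_pow_eq (a : Fin n → ℕ) (k : Fin n) :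
    (∏ i ∈ Finset.univ.erase k, if i < k then 1 else q ^ a i) =
      q ^ (total a - partialSum a k) := by
  have h1 : total a - partialSum a k = ∑ i ∈ Finset.Ioi k, a i := by
    have : total a = partialSum a k + ∑ i ∈ Finset.Ioi k, a i := by
      rw [total, partialSum, ← Finset.sum_union]
      · congr 1
        ext i
        simpa using le_or_gt i k
      · exact Finset.disjoint_left.mpr fun i hi hi' =>
          absurd (Finset.mem_Iic.mp hi) (Finset.mem_Ioi.mp hi').not_ge
    omega
  rw [h1, ← Finset.prod_pow_eq_pow_sum]
  symm
  refine Finset.prod_subset_one_on_sdiff (fun i hi => ?_) (fun i hi => ?_) fun i hi => ?_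
  · exact Finset.mem_erase.mpr ⟨(Finset.mem_Ioi.mp hi).ne', Finset.mem_univ i⟩
  · rw [Finset.mem_sdiff, Finset.mem_erase, Finset.mem_Ioi, not_lt] at hi
    rw [if_pos (lt_of_le_of_ne hi.2 hi.1.1)]
  · rw [if_neg (Finset.mem_Ioi.mp hi).not_gt]

theorem D_single (a : Fin n → ℕ) (k : Fin n) (m : ℕ) (hm : 0 < m) :
    D (Pi.single k m) m a =
      q ^ (total a - partialSum a k) * (1 - q ^ a k) * qPoch q (q ^ total a) m /
        ((1 - q ^ total a) * qPoch q (q ^ (total a - a k + 1)) m) * qMultinomial a := by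
  rw [D_eq_coeff]
  rcases Nat.eq_zero_or_pos (a k) with hak | hak
  · rw [coeff_complete_mul_dysonPoly_eq_zero q_pow_injective a _ m hm (by simp)]
    · simp [hak]
    · intro i hi
      rw [Pi.single_eq_of_ne (by rintro rfl; omega)]
      exact hm
  · obtain ⟨r, hr⟩ : ∃ r, a k = r + 1 := ⟨a k - 1, by omega⟩
    obtain ⟨b, hb⟩ : ∃ b, ∑ i ∈ Finset.univ.erase k, a i = b := ⟨_, rfl⟩
    have htot : total a = b + r + 1 := by
      rw [total, ← Finset.sum_erase_add _ _ (Finset.mem_univ k), hb, hr, add_assoc]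
    rw [coeff_complete_mul_dysonPoly_single q_pow_injective a k m b r hm hr hb, prod_ite_pow_eq,
      qMultinomial, ← Finset.mul_prod_erase _ _ (Finset.mem_univ k), hr]
    have hprod : (∏ i ∈ Finset.univ.erase k, qPoch q q (a i)) ≠ 0 :=
      Finset.prod_ne_zero_iff.mpr fun i _ => qPoch_ne_zero q_pow_injective _
    generalize q ^ (total a - partialSum a k) = z
    rw [htot, show b + r + 1 - (r + 1) + 1 = b + 1 by omega, qPoch_add b m,
      show b + m + r = b + r + m by omega, qPoch_add (b + r) m, qPoch_succ (b + r), qPoch_succ r]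
    have h1 := qPoch_ne_zero q_pow_injective b
    have h2 := qPoch_ne_zero q_pow_injective r
    have h3 := qPoch_pow_ne_zero q_pow_injective b m
    have h4 := one_sub_pow_ne_zero q_pow_injective (b + r + 1) (by omega)
    have h5 := one_sub_pow_ne_zero q_pow_injective (r + 1) (by omega)
    generalize qPoch q (q ^ (b + 1)) m = y3 at *
    generalize 1 - q ^ (b + r + 1) = y4 at *
    generalize 1 - q ^ (r + 1) = y5 at *
    field_simp

end Final

end Kadell

theorem theorem1p3 {n : ℕ} (m : ℕ) (hm : 0 < m) (v a : Fin n → ℕ) :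
    (Kadell.sortedParts v ≠ [m] → Kadell.D v m a = 0) ∧
    (∀ k : Fin n, v = Pi.single k m →
      Kadell.D v m a =
        Kadell.q ^ (Kadell.total a - Kadell.partialSum a k) * (1 - Kadell.q ^ a k) *
            Kadell.qPoch Kadell.q (Kadell.q ^ Kadell.total a) m /
          ((1 - Kadell.q ^ Kadell.total a) *
            Kadell.qPoch Kadell.q (Kadell.q ^ (Kadell.total a - a k + 1)) m) *
          Kadell.qMultinomial a) := by
  constructor
  · intro hsort
    by_cases hv : ∑ i, v i = m
    · rw [Kadell.D_eq_coeff]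
      refine Kadell.coeff_complete_mul_dysonPoly_eq_zero Kadell.q_pow_injective a v m hm hv
        fun i _ => ?_
      by_contra! hi
      refine hsort ?_
      rw [Kadell.eq_single_of_le v m hv i hi, Kadell.sortedParts_single i m hm]
    · exact Kadell.D_eq_zero_of_sum_ne v a m hv
  · rintro k rfl
    exact Kadell.D_single a k m hm
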